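/- Let $\sigma_x,\sigma_v,\sigma_w>0$ and let $x\sim\mathcal N(0,\sigma_x^2)$, $v\sim\mathcal N(0,\sigma_v^2)$, $w\sim\mathcal N(0,\sigma_w^2)$ be independent. An encoder is a measurable function $\gamma^e:\mathbb R\to\mathbb R$ whose message $m=\gamma^e(x)$ has finite power $P=\mathbf E[m^2]$. A decoder consists of a combining parameter $\alpha\in[0,1]$ and a measurable function $\gamma^d:\mathbb R\to\mathbb R$; it receives $$r=\alpha\,(m+v)+(1-\alpha)\,(x+w)$$ and forms the estimate $\hat x=\gamma^d(r)$. Then, for every encoder and every decoder, $$\mathbf E[(x-\hat x)^2]\;\ge\;\frac{\sigma_x^2}{\frac{P}{\sigma_v^2}+\frac{\sigma_x^2}{\sigma_w^2}+1}$$ (the left-hand side may be $+\infty$). Moreover, equality holds if and only if the encoder and the decoder jointly use matched linear strategies, that is, if and only if there is a real number $A\ge 0$ such that, almost surely, $m=Ax$ and $\hat x=K r$, where $$\alpha=\frac{A\sigma_w^2}{A\sigma_w^2+\sigma_v^2},\qquad K=\frac{A\sigma_x^2\sigma_w^2+\sigma_x^2\sigma_v^2}{A^2\sigma_x^2\sigma_w^2+\sigma_x^2\sigma_v^2+\sigma_w^2\sigma_v^2}.$$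 -/

import Mathlib

open MeasureTheory ProbabilityTheory
open scoped NNReal ENNReal

noncomputable section

/-- The decoder's input `r = α y + (1 - α) z`, where `y = m + v` is the noisy version of the
message `m = γe(x)` and `z = x + w` is the noisy side observation of the source. -/
def decoderInput {Ω : Type*} (x v w : Ω → ℝ) (γe : ℝ → ℝ) (α : ℝ) : Ω → ℝ :=
  fun ω => α * (γe (x ω) + v ω) + (1 - α) * (x ω + w ω)

/-- The power `E[m²]` of the transmitted message `m = γe(x)`. -/
def messagePower {Ω : Type*} [MeasurableSpace Ω] (μ : Measure Ω) (x : Ω → ℝ)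
    (γe : ℝ → ℝ) : ℝ :=
  ∫ ω, (γe (x ω)) ^ 2 ∂μ

/-- The mean-square estimation error `E[(x - x̂)²]` with `x̂ = γd(r)`, as an extended nonnegative
real: it is `∞` exactly when the error is not square integrable. -/
def estimationError {Ω : Type*} [MeasurableSpace Ω] (μ : Measure Ω) (x v w : Ω → ℝ)
    (γe : ℝ → ℝ) (α : ℝ) (γd : ℝ → ℝ) : ℝ≥0∞ :=
  ∫⁻ ω, ENNReal.ofReal ((x ω - γd (decoderInput x v w γe α ω)) ^ 2) ∂μ

/-- The optimal combining parameter for the linear encoder `m = A x` with `A ≥ 0`. -/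
def optimalCombining (σv σw A : ℝ) : ℝ :=
  A * σw ^ 2 / (A * σw ^ 2 + σv ^ 2)

/-- The optimal gain of the linear decoder `x̂ = K r` for the linear encoder `m = A x`
with `A ≥ 0`. -/
def optimalGain (σx σv σw A : ℝ) : ℝ :=
  (A * σx ^ 2 * σw ^ 2 + σx ^ 2 * σv ^ 2) /
    (A ^ 2 * σx ^ 2 * σw ^ 2 + σx ^ 2 * σv ^ 2 + σw ^ 2 * σv ^ 2)

end

/-! The decoder sees a scalar Gaussian channel `r = f(x) + N`, with `f(t) = α γe(t) + (1 - α) t` and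
`N = α v + (1 - α) w` of variance `b`, independent of `x`. With `Q = E[f(x)²]`, any decoder has
error at least `σx² b / (Q + b)`. This comes from comparing the joint law with a Gaussian backward
channel: the density ratio `exp Λ` has mean one, and `exp Λ ≥ Λ + 1` gives `E[Λ] ≤ 0`, which is the
bound.

It remains to bound `(Q + b) / b` by the target denominator. By `combining_snr_gap` the slack is a
square, vanishing only at the optimal `α`, plus a Cauchy–Schwarz term measuring how far `m` is from
`A x`. Equality forces both to vanish, so the encoder is linear; for a linear encoder the error of
the linear estimate is independent of `r`, so the optimal decoder is unique. -/

/-! ### Backward test channel -/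

/-- The condition `a * b = s * c` makes the normalizing constants agree, so the density ratio is a
pure exponential. -/
lemma gaussianPDF_mul_gaussianPDF_mul_exp {a b c s : ℝ≥0} (h : a * b = s * c)
    (x n r y : ℝ) :
    gaussianPDF 0 a x * (gaussianPDF 0 b n * ENNReal.ofReal (Real.exp
      (x ^ 2 / (2 * a) + n ^ 2 / (2 * b) - (x - y) ^ 2 / (2 * s) - r ^ 2 / (2 * c)))) =
    gaussianPDF y s x * gaussianPDF 0 c r := by
  have h' : (a : ℝ) * b = s * c := mod_cast h
  simp only [gaussianPDF]
  rw [← ENNReal.ofReal_mul (gaussianPDFReal_nonneg _ _ _),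
    ← ENNReal.ofReal_mul (gaussianPDFReal_nonneg _ _ _),
    ← ENNReal.ofReal_mul (gaussianPDFReal_nonneg _ _ _)]
  congr 1
  have hsqrt : √(2 * Real.pi * a) * √(2 * Real.pi * b) =
      √(2 * Real.pi * s) * √(2 * Real.pi * c) := by
    rw [← Real.sqrt_mul (by positivity), ← Real.sqrt_mul (by positivity)]
    congr 1
    linear_combination (4 * Real.pi ^ 2) * h'
  have hexp : Real.exp (-(x - 0) ^ 2 / (2 * a)) * (Real.exp (-(n - 0) ^ 2 / (2 * b)) *
      Real.exp (x ^ 2 / (2 * a) + n ^ 2 / (2 * b) - (x - y) ^ 2 / (2 * s) - r ^ 2 / (2 * c))) =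
      Real.exp (-(x - y) ^ 2 / (2 * s)) * Real.exp (-(r - 0) ^ 2 / (2 * c)) := by
    simp only [← Real.exp_add]
    congr 1
    ring
  simp only [gaussianPDFReal]
  calc _ = (√(2 * Real.pi * a) * √(2 * Real.pi * b))⁻¹ *
        (Real.exp (-(x - 0) ^ 2 / (2 * a)) * (Real.exp (-(n - 0) ^ 2 / (2 * b)) *
        Real.exp (x ^ 2 / (2 * a) + n ^ 2 / (2 * b) - (x - y) ^ 2 / (2 * s) - r ^ 2 / (2 * c)))) := by
        rw [mul_inv]; ring
    _ = _ := by rw [hexp, hsqrt, mul_inv]; ring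

/-- The ratio of the density of a "backward test channel" to the joint density of the input `x`
and the noise `n` of the additive Gaussian channel `r = f x + n` has expectation one. -/
lemma lintegral_exp_gaussian_backward_channel {a b c s : ℝ≥0} (ha : a ≠ 0) (hb : b ≠ 0)
    (hc : c ≠ 0) (hs : s ≠ 0) (h : a * b = s * c) {f g : ℝ → ℝ} (hf : Measurable f)
    (hg : Measurable g) :
    ∫⁻ p : ℝ × ℝ, ENNReal.ofReal (Real.exp
      (p.1 ^ 2 / (2 * a) + p.2 ^ 2 / (2 * b) - (p.1 - g (f p.1 + p.2)) ^ 2 / (2 * s)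
        - (f p.1 + p.2) ^ 2 / (2 * c))) ∂((gaussianReal 0 a).prod (gaussianReal 0 b)) = 1 := by
  rw [lintegral_prod _ (by fun_prop)]
  have hinner (x : ℝ) : gaussianPDF 0 a x * ∫⁻ n, ENNReal.ofReal (Real.exp
      (x ^ 2 / (2 * a) + n ^ 2 / (2 * b) - (x - g (f x + n)) ^ 2 / (2 * s)
        - (f x + n) ^ 2 / (2 * c))) ∂(gaussianReal 0 b) =
      ∫⁻ r, gaussianPDF (g r) s x * gaussianPDF 0 c r := by
    rw [gaussianReal_of_var_ne_zero _ hb,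
      lintegral_withDensity_eq_lintegral_mul _ (measurable_gaussianPDF _ _) (by fun_prop),
      ← lintegral_const_mul' _ _ gaussianPDF_ne_top]
    simp only [Pi.mul_apply, gaussianPDF_mul_gaussianPDF_mul_exp h]
    -- Substitute `r = f x + n`, using translation invariance of Lebesgue measure.
    exact lintegral_add_left_eq_self (fun r ↦ gaussianPDF (g r) s x * gaussianPDF 0 c r) (f x)
  have hmeas : Measurable fun p : ℝ × ℝ ↦ gaussianPDF (g p.2) s p.1 * gaussianPDF 0 c p.2 := by
    have h1 := measurable_uncurry_gaussianPDF
    exact (h1.comp (f := fun p : ℝ × ℝ ↦ (g p.2, s, p.1)) (by fun_prop)).mul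
      (h1.comp (f := fun p : ℝ × ℝ ↦ ((0 : ℝ), c, p.2)) (by fun_prop))
  rw [gaussianReal_of_var_ne_zero _ ha,
    lintegral_withDensity_eq_lintegral_mul _ (measurable_gaussianPDF _ _)
      (Measurable.lintegral_prod_right' (f := fun p : ℝ × ℝ ↦ ENNReal.ofReal (Real.exp
      (p.1 ^ 2 / (2 * a) + p.2 ^ 2 / (2 * b) - (p.1 - g (f p.1 + p.2)) ^ 2 / (2 * s)
        - (f p.1 + p.2) ^ 2 / (2 * c)))) (by fun_prop))]
  simp only [Pi.mul_apply, hinner]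
  -- With `x` integrated first, `g r` is only the mean of a Gaussian density, so `g` may be
  -- arbitrary.
  rw [lintegral_lintegral_swap hmeas.aemeasurable]
  simp_rw [lintegral_mul_const' _ _ gaussianPDF_ne_top, lintegral_gaussianPDF_eq_one _ hs, one_mul]
  exact lintegral_gaussianPDF_eq_one _ hc

/-! ### Second moments and the lower bound for a scalar channel -/

section

variable {Ω : Type*} [MeasurableSpace Ω] {μ : Measure Ω}

lemma ProbabilityTheory.HasLaw.integral_eq_zero_of_gaussianReal {X : Ω → ℝ} {a : ℝ≥0}
    (hX : HasLaw X (gaussianReal 0 a) μ) : ∫ ω, X ω ∂μ = 0 := by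
  rw [hX.integral_eq, integral_id_gaussianReal]

lemma ProbabilityTheory.HasLaw.integral_sq_of_gaussianReal {X : Ω → ℝ} {a : ℝ≥0}
    (hX : HasLaw X (gaussianReal 0 a) μ) : ∫ ω, X ω ^ 2 ∂μ = a := by
  rw [← variance_of_integral_eq_zero hX.aemeasurable hX.integral_eq_zero_of_gaussianReal,
    hX.variance_eq, variance_id_gaussianReal]

lemma ProbabilityTheory.HasLaw.memLp_two_of_gaussianReal {X : Ω → ℝ} {m : ℝ} {a : ℝ≥0}
    (hX : HasLaw X (gaussianReal m a) μ) : MemLp X 2 μ :=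
  hX.hasGaussianLaw.memLp_two

lemma memLp_two_of_lintegral_sq_ne_top {Y : Ω → ℝ} (hY : AEStronglyMeasurable Y μ)
    (h : ∫⁻ ω, ENNReal.ofReal (Y ω ^ 2) ∂μ ≠ ∞) : MemLp Y 2 μ := by
  rw [memLp_two_iff_integrable_sq hY]
  refine ⟨hY.pow 2, ?_⟩
  rw [hasFiniteIntegral_iff_ofReal (ae_of_all _ fun _ ↦ sq_nonneg _)]
  exact h.lt_top

lemma MeasureTheory.MemLp.lintegral_ofReal_sq {Y : Ω → ℝ} (hY : MemLp Y 2 μ) :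
    ∫⁻ ω, ENNReal.ofReal (Y ω ^ 2) ∂μ = ENNReal.ofReal (∫ ω, Y ω ^ 2 ∂μ) :=
  (ofReal_integral_eq_lintegral_ofReal hY.integrable_sq (ae_of_all _ fun _ ↦ sq_nonneg _)).symm

lemma integral_sq_linear_combination {U V : Ω → ℝ} (hU : MemLp U 2 μ) (hV : MemLp V 2 μ)
    (p q : ℝ) : ∫ ω, (p * U ω + q * V ω) ^ 2 ∂μ =
      p ^ 2 * ∫ ω, U ω ^ 2 ∂μ + 2 * p * q * ∫ ω, U ω * V ω ∂μ + q ^ 2 * ∫ ω, V ω ^ 2 ∂μ := by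
  have i1 : Integrable (fun ω ↦ p ^ 2 * U ω ^ 2) μ := hU.integrable_sq.const_mul _
  have i2 : Integrable (fun ω ↦ 2 * p * q * (U ω * V ω)) μ := (hU.integrable_mul hV).const_mul _
  have i3 : Integrable (fun ω ↦ q ^ 2 * V ω ^ 2) μ := hV.integrable_sq.const_mul _
  have i12 : Integrable (fun ω ↦ p ^ 2 * U ω ^ 2 + 2 * p * q * (U ω * V ω)) μ := i1.add i2
  rw [← integral_const_mul, ← integral_const_mul, ← integral_const_mul, ← integral_add i1 i2,
    ← integral_add i12 i3]
  congr 1 with ω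
  ring

lemma MeasureTheory.MemLp.ae_eq_zero_of_integral_sq_eq_zero {Y : Ω → ℝ} (hY : MemLp Y 2 μ)
    (h : ∫ ω, Y ω ^ 2 ∂μ = 0) : ∀ᵐ ω ∂μ, Y ω = 0 := by
  have := (integral_eq_zero_iff_of_nonneg (fun ω ↦ sq_nonneg (Y ω)) hY.integrable_sq).1 h
  filter_upwards [this] with ω hω
  exact pow_eq_zero_iff two_ne_zero |>.1 hω

variable [IsProbabilityMeasure μ] {X N : Ω → ℝ} {a b : ℝ≥0} {f g : ℝ → ℝ}

lemma gaussianChannel_integral_sq_error_ge (ha : a ≠ 0) (hb : b ≠ 0)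
    (hX : HasLaw X (gaussianReal 0 a) μ) (hN : HasLaw N (gaussianReal 0 b) μ)
    (hXN : IndepFun X N μ) (hf : Measurable f) (hg : Measurable g)
    (hfX : MemLp (fun ω ↦ f (X ω)) 2 μ)
    (hgr : MemLp (fun ω ↦ X ω - g (f (X ω) + N ω)) 2 μ) :
    (a * b : ℝ) / (∫ ω, f (X ω) ^ 2 ∂μ + b) ≤ ∫ ω, (X ω - g (f (X ω) + N ω)) ^ 2 ∂μ := by
  set Q := ∫ ω, f (X ω) ^ 2 ∂μ with hQ
  have hQ0 : 0 ≤ Q := integral_nonneg fun ω ↦ sq_nonneg _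
  have ha' : 0 < (a : ℝ) := by positivity
  have hb' : 0 < (b : ℝ) := by positivity
  -- `c` is the second moment of the channel output; `s = a b / c` is the claimed minimal error.
  obtain ⟨c, hc⟩ : ∃ c : ℝ≥0, (c : ℝ) = Q + b := ⟨⟨Q + b, by positivity⟩, rfl⟩
  have hc' : 0 < (c : ℝ) := by rw [hc]; positivity
  obtain ⟨s, hs⟩ : ∃ s : ℝ≥0, (s : ℝ) = a * b / c := ⟨⟨a * b / c, by positivity⟩, rfl⟩
  have hs' : 0 < (s : ℝ) := by rw [hs]; positivity
  have hsc : a * b = s * c := by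
    apply NNReal.coe_injective
    push_cast
    rw [hs, div_mul_cancel₀ _ hc'.ne']
  rw [← hc, ← hs]
  have hNL := hN.memLp_two_of_gaussianReal
  have hXL := hX.memLp_two_of_gaussianReal
  have hcross : ∫ ω, f (X ω) * N ω ∂μ = 0 := by
    have := (hXN.comp hf measurable_id).integral_fun_mul_eq_mul_integral
      hfX.aestronglyMeasurable hNL.aestronglyMeasurable
    simpa [hN.integral_eq_zero_of_gaussianReal] using this
  have hr2 : ∫ ω, (f (X ω) + N ω) ^ 2 ∂μ = c := by
    have := integral_sq_linear_combination hfX hNL 1 1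
    simp only [one_mul, mul_one, one_pow, hcross, hN.integral_sq_of_gaussianReal] at this
    rw [this, hc]
    ring
  set Λ : Ω → ℝ := fun ω ↦ X ω ^ 2 / (2 * a) + N ω ^ 2 / (2 * b)
    - (X ω - g (f (X ω) + N ω)) ^ 2 / (2 * s) - (f (X ω) + N ω) ^ 2 / (2 * c) with hΛ
  have i1 : Integrable (fun ω ↦ X ω ^ 2 / (2 * a : ℝ)) μ := hXL.integrable_sq.div_const _
  have i2 : Integrable (fun ω ↦ N ω ^ 2 / (2 * b : ℝ)) μ := hNL.integrable_sq.div_const _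
  have i3 : Integrable (fun ω ↦ (X ω - g (f (X ω) + N ω)) ^ 2 / (2 * s : ℝ)) μ :=
    hgr.integrable_sq.div_const _
  have i4 : Integrable (fun ω ↦ (f (X ω) + N ω) ^ 2 / (2 * c : ℝ)) μ :=
    (hfX.add hNL).integrable_sq.div_const _
  have i12 : Integrable (fun ω ↦ X ω ^ 2 / (2 * a : ℝ) + N ω ^ 2 / (2 * b : ℝ)) μ := i1.add i2
  have i123 : Integrable (fun ω ↦ X ω ^ 2 / (2 * a : ℝ) + N ω ^ 2 / (2 * b : ℝ)
    - (X ω - g (f (X ω) + N ω)) ^ 2 / (2 * s : ℝ)) μ := i12.sub i3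
  have hΛi : Integrable Λ μ := i123.sub i4
  have hΛval : ∫ ω, Λ ω ∂μ = 1 / 2 - (∫ ω, (X ω - g (f (X ω) + N ω)) ^ 2 ∂μ) / (2 * s) := by
    simp only [hΛ]
    rw [integral_sub i123 i4, integral_sub i12 i3, integral_add i1 i2]
    simp only [integral_div, hr2, hX.integral_sq_of_gaussianReal, hN.integral_sq_of_gaussianReal]
    field_simp
    ring
  have hexp : ∫⁻ ω, ENNReal.ofReal (Real.exp (Λ ω)) ∂μ = 1 := by
    have hlaw := (indepFun_iff_hasLaw_prodMk_prod hX hN).1 hXN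
    rw [← lintegral_exp_gaussian_backward_channel ha hb (NNReal.coe_pos.1 hc').ne'
      (NNReal.coe_pos.1 hs').ne' hsc hf hg, ← hlaw.lintegral_comp (by fun_prop)]
  have hexpi : Integrable (fun ω ↦ Real.exp (Λ ω)) μ := by
    refine ⟨Real.continuous_exp.comp_aestronglyMeasurable hΛi.aestronglyMeasurable, ?_⟩
    rw [hasFiniteIntegral_iff_ofReal (ae_of_all _ fun ω ↦ (Real.exp_pos _).le), hexp]
    exact ENNReal.one_lt_top
  have hexpval : ∫ ω, Real.exp (Λ ω) ∂μ = 1 := by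
    rw [integral_eq_lintegral_of_nonneg_ae (ae_of_all _ fun ω ↦ (Real.exp_pos _).le)
      hexpi.aestronglyMeasurable, hexp, ENNReal.toReal_one]
  -- Nonnegativity of relative entropy, in the form `E[Λ] ≤ 0`.
  have hle : ∫ ω, (Λ ω + 1) ∂μ ≤ ∫ ω, Real.exp (Λ ω) ∂μ :=
    integral_mono (hΛi.add (integrable_const 1)) hexpi fun ω ↦ Real.add_one_le_exp _
  rw [hexpval, integral_add hΛi (integrable_const 1), hΛval] at hle
  simp only [integral_const, probReal_univ, smul_eq_mul, mul_one] at hle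
  have : 1 / 2 ≤ (∫ ω, (X ω - g (f (X ω) + N ω)) ^ 2 ∂μ) / (2 * s) := by linarith
  rw [le_div_iff₀ (by positivity)] at this
  linarith

/-- Every encoder and decoder for a Gaussian source `X` and an additive Gaussian noise channel have
mean-square error at least the linear one with the same input power. -/
lemma gaussianChannel_lintegral_sq_error_ge (ha : a ≠ 0) (hb : b ≠ 0)
    (hX : HasLaw X (gaussianReal 0 a) μ) (hN : HasLaw N (gaussianReal 0 b) μ)
    (hXN : IndepFun X N μ) (hf : Measurable f) (hg : Measurable g)
    (hfX : MemLp (fun ω ↦ f (X ω)) 2 μ) :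
    ENNReal.ofReal ((a * b : ℝ) / (∫ ω, f (X ω) ^ 2 ∂μ + b)) ≤
      ∫⁻ ω, ENNReal.ofReal ((X ω - g (f (X ω) + N ω)) ^ 2) ∂μ := by
  by_cases hfin : ∫⁻ ω, ENNReal.ofReal ((X ω - g (f (X ω) + N ω)) ^ 2) ∂μ = ∞
  · rw [hfin]; exact le_top
  have hm : AEMeasurable (fun ω ↦ X ω - g (f (X ω) + N ω)) μ := by
    have := hX.aemeasurable
    have := hN.aemeasurable
    fun_prop
  have hL := memLp_two_of_lintegral_sq_ne_top hm.aestronglyMeasurable hfin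
  rw [hL.lintegral_ofReal_sq]
  exact ENNReal.ofReal_le_ofReal (gaussianChannel_integral_sq_error_ge ha hb hX hN hXN hf hg hfX hL)

end

/-! ### Uniqueness of the optimal decoder for a linear encoder -/

section

variable {Ω : Type*} [MeasurableSpace Ω] {μ : Measure Ω} [IsProbabilityMeasure μ]

/-- The estimation error of the linear minimum mean-square estimator of `X` from `β X + N` is
independent of the observation. -/
lemma indepFun_sub_linear_estimate {X N : Ω → ℝ} {a b : ℝ≥0} (hb : b ≠ 0)
    (hX : HasLaw X (gaussianReal 0 a) μ) (hN : HasLaw N (gaussianReal 0 b) μ)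
    (hXN : IndepFun X N μ) (β : ℝ) :
    IndepFun (fun ω ↦ X ω - β * a / (β ^ 2 * a + b) * (β * X ω + N ω))
      (fun ω ↦ β * X ω + N ω) μ := by
  set K : ℝ := β * a / (β ^ 2 * a + b) with hK
  have hb' : 0 < (b : ℝ) := by positivity
  have hXL := hX.memLp_two_of_gaussianReal
  have hNL := hN.memLp_two_of_gaussianReal
  have hrL : MemLp (fun ω ↦ β * X ω + N ω) 2 μ := (hXL.const_mul β).add hNL
  have hYL : MemLp (fun ω ↦ X ω - K * (β * X ω + N ω)) 2 μ := hXL.sub (hrL.const_mul K)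
  have hXN0 : cov[X, N; μ] = 0 := hXN.covariance_eq_zero hXL hNL
  have hVX : cov[X, X; μ] = a := by
    rw [covariance_self hX.aemeasurable, hX.variance_eq, variance_id_gaussianReal]
  have hVN : cov[N, N; μ] = b := by
    rw [covariance_self hN.aemeasurable, hN.variance_eq, variance_id_gaussianReal]
  have hr (Z : Ω → ℝ) (hZ : MemLp Z 2 μ) :
      cov[Z, fun ω ↦ β * X ω + N ω; μ] = β * cov[Z, X; μ] + cov[Z, N; μ] := by
    have := covariance_add_right hZ (hXL.const_mul β) hNL
    rw [covariance_const_mul_right] at this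
    exact this
  refine HasGaussianLaw.indepFun_of_covariance_eq_zero ?_ ?_
  · have hG : HasGaussianLaw (fun ω ↦ (X ω, N ω)) μ :=
      IndepFun.hasGaussianLaw hX.hasGaussianLaw hN.hasGaussianLaw hXN
    let fst := ContinuousLinearMap.fst ℝ ℝ ℝ
    let snd := ContinuousLinearMap.snd ℝ ℝ ℝ
    exact hG.map_fun ((fst - K • (β • fst + snd)).prod (β • fst + snd))
  · rw [covariance_fun_sub_left hXL (hrL.const_mul K) hrL, covariance_const_mul_left,
      hr _ hXL, hr _ hrL, covariance_comm (fun ω ↦ β * X ω + N ω) X,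
      covariance_comm (fun ω ↦ β * X ω + N ω) N, hr _ hXL, hr _ hNL,
      covariance_comm N X, hXN0, hVX, hVN, hK]
    field_simp
    ring

/-- The linear minimum mean-square estimator is the unique best decoder for a Gaussian source and
a linear encoder over an additive Gaussian noise channel. -/
lemma gaussianChannel_lintegral_sq_error_eq_iff {X N : Ω → ℝ} {a b : ℝ≥0} {g : ℝ → ℝ} (hb : b ≠ 0)
    (hX : HasLaw X (gaussianReal 0 a) μ) (hN : HasLaw N (gaussianReal 0 b) μ)
    (hXN : IndepFun X N μ) (hg : Measurable g) (β : ℝ) :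
    ∫⁻ ω, ENNReal.ofReal ((X ω - g (β * X ω + N ω)) ^ 2) ∂μ =
        ENNReal.ofReal (a * b / (β ^ 2 * a + b)) ↔
      ∀ᵐ ω ∂μ, g (β * X ω + N ω) = β * a / (β ^ 2 * a + b) * (β * X ω + N ω) := by
  have hind := indepFun_sub_linear_estimate hb hX hN hXN β
  set K : ℝ := β * a / (β ^ 2 * a + b) with hK
  have hb' : 0 < (b : ℝ) := by positivity
  have hXL := hX.memLp_two_of_gaussianReal
  have hNL := hN.memLp_two_of_gaussianReal
  have hrL : MemLp (fun ω ↦ β * X ω + N ω) 2 μ := (hXL.const_mul β).add hNL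
  have hYL : MemLp (fun ω ↦ X ω - K * (β * X ω + N ω)) 2 μ := hXL.sub (hrL.const_mul K)
  have hcross : ∫ ω, X ω * N ω ∂μ = 0 := by
    have := hXN.integral_fun_mul_eq_mul_integral hXL.aestronglyMeasurable hNL.aestronglyMeasurable
    simpa [hN.integral_eq_zero_of_gaussianReal] using this
  have hY2 : ∫ ω, (X ω - K * (β * X ω + N ω)) ^ 2 ∂μ = a * b / (β ^ 2 * a + b) := by
    have h := integral_sq_linear_combination hXL hNL (1 - K * β) (-K)
    rw [hcross, hX.integral_sq_of_gaussianReal, hN.integral_sq_of_gaussianReal] at h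
    have e (ω : Ω) : X ω - K * (β * X ω + N ω) = (1 - K * β) * X ω + -K * N ω := by ring
    simp only [e]
    rw [h, hK]
    field_simp
    ring
  constructor
  · intro h
    have hm : AEMeasurable (fun ω ↦ X ω - g (β * X ω + N ω)) μ := by
      have := hX.aemeasurable
      have := hN.aemeasurable
      fun_prop
    have hL := memLp_two_of_lintegral_sq_ne_top hm.aestronglyMeasurable
      (h.trans_ne ENNReal.ofReal_ne_top)
    have hDL : MemLp (fun ω ↦ K * (β * X ω + N ω) - g (β * X ω + N ω)) 2 μ := by
      convert! hL.sub hYL using 1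
      ext ω
      simp
    have hY0 : ∫ ω, (X ω - K * (β * X ω + N ω)) ∂μ = 0 := by
      have iX : Integrable X μ := hXL.integrable one_le_two
      have iN : Integrable N μ := hNL.integrable one_le_two
      have ir : Integrable (fun ω ↦ β * X ω + N ω) μ := (iX.const_mul β).add iN
      rw [integral_sub iX (ir.const_mul K), integral_const_mul,
        integral_add (iX.const_mul β) iN, integral_const_mul,
        hX.integral_eq_zero_of_gaussianReal, hN.integral_eq_zero_of_gaussianReal]
      simp
    -- The linear estimate's error is centred and independent of the observation, hence orthogonal
    -- to every square-integrable function of it. By Pythagoras, any deviation from the linear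
    -- decoder adds its own mean square.
    have horth : ∫ ω, (X ω - K * (β * X ω + N ω)) *
        (K * (β * X ω + N ω) - g (β * X ω + N ω)) ∂μ = 0 := by
      have := (hind.comp measurable_id (by fun_prop :
        Measurable fun r ↦ K * r - g r)).integral_fun_mul_eq_mul_integral
          hYL.aestronglyMeasurable hDL.aestronglyMeasurable
      simpa [hY0] using this
    have hsum := integral_sq_linear_combination hYL hDL 1 1
    simp only [one_mul, one_pow, mul_one, sub_add_sub_cancel, horth, hY2] at hsum
    rw [hL.lintegral_ofReal_sq, ENNReal.ofReal_eq_ofReal_iff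
      (integral_nonneg fun _ ↦ sq_nonneg _) (by positivity)] at h
    filter_upwards [hDL.ae_eq_zero_of_integral_sq_eq_zero (by linarith)] with ω hω
    linarith
  · intro h
    rw [← hY2, ← hYL.lintegral_ofReal_sq]
    refine lintegral_congr_ae ?_
    filter_upwards [h] with ω hω
    rw [hω]

end

/-! ### Combined noise and signal-to-noise ratio -/

section

variable {Ω : Type*} [MeasurableSpace Ω] {μ : Measure Ω} {v w : Ω → ℝ}

lemma hasLaw_linear_combination_gaussianReal {a b : ℝ≥0} (hv : HasLaw v (gaussianReal 0 a) μ)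
    (hw : HasLaw w (gaussianReal 0 b) μ) (hvw : IndepFun v w μ) (p q : ℝ) :
    ∃ c : ℝ≥0, (c : ℝ) = p ^ 2 * a + q ^ 2 * b ∧
      HasLaw (fun ω ↦ p * v ω + q * w ω) (gaussianReal 0 c) μ := by
  have hpv := gaussianReal_const_mul hv p
  have hqw := gaussianReal_const_mul hw q
  refine ⟨.mk (p ^ 2) (sq_nonneg _) * a + .mk (q ^ 2) (sq_nonneg _) * b, by simp,
    ⟨hpv.aemeasurable.add hqw.aemeasurable, ?_⟩⟩
  · have := gaussianReal_add_gaussianReal_of_indepFun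
      (hvw.comp (measurable_const_mul p) (measurable_const_mul q)) hpv.map_eq hqw.map_eq
    rw [mul_zero, mul_zero, add_zero] at this
    exact this

/-- The Cauchy–Schwarz gap between the signal-to-noise ratio of the combined observation and its
bound. -/
lemma combining_snr_gap {sx sv sw A α C b Q T : ℝ} (hsv : sv ≠ 0)
    (hsw : sw ≠ 0) (hb : b = α ^ 2 * sv ^ 2 + (1 - α) ^ 2 * sw ^ 2)
    (hQ : Q = α ^ 2 * (A ^ 2 * sx ^ 2) + 2 * α * (1 - α) * C + (1 - α) ^ 2 * sx ^ 2)
    (hT : T = A ^ 2 * sx ^ 2 / sv ^ 2 + sx ^ 2 / sw ^ 2 + 1) :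
    b * T - (Q + b) = (α * sv * sx / sw - (1 - α) * sw * A * sx / sv) ^ 2 +
      2 * (α * (1 - α)) * (A * sx ^ 2 - C) := by
  subst hb hQ hT
  field_simp
  ring

lemma combining_noise_pos {sv sw α : ℝ} (hsv : 0 < sv) (hsw : 0 < sw) :
    0 < α ^ 2 * sv ^ 2 + (1 - α) ^ 2 * sw ^ 2 := by
  by_cases h : α = 0
  · subst h; simpa using pow_pos hsw 2
  · have : 0 < α ^ 2 := by positivity
    positivity

end

/-! ### The bound and its equality case -/

theorem mainTheorem4 {Ω : Type*} [MeasurableSpace Ω] (μ : Measure Ω) [IsProbabilityMeasure μ]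
    (σx σv σw : ℝ≥0) (hσx : 0 < σx) (hσv : 0 < σv) (hσw : 0 < σw)
    (x v w : Ω → ℝ)
    (hx : HasLaw x (gaussianReal 0 (σx ^ 2)) μ)
    (hv : HasLaw v (gaussianReal 0 (σv ^ 2)) μ)
    (hw : HasLaw w (gaussianReal 0 (σw ^ 2)) μ)
    (hindep : iIndepFun ![x, v, w] μ)
    (γe : ℝ → ℝ) (hγe : Measurable γe) (hpow : Integrable (fun ω => (γe (x ω)) ^ 2) μ)
    (P : ℝ) (hP : P = messagePower μ x γe)
    (α : ℝ) (hα : α ∈ Set.Icc (0 : ℝ) 1)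
    (γd : ℝ → ℝ) (hγd : Measurable γd) :
    ENNReal.ofReal ((σx : ℝ) ^ 2 / (P / (σv : ℝ) ^ 2 + (σx : ℝ) ^ 2 / (σw : ℝ) ^ 2 + 1))
        ≤ estimationError μ x v w γe α γd ∧
      (estimationError μ x v w γe α γd =
          ENNReal.ofReal ((σx : ℝ) ^ 2 / (P / (σv : ℝ) ^ 2 + (σx : ℝ) ^ 2 / (σw : ℝ) ^ 2 + 1)) ↔
        ∃ A : ℝ, 0 ≤ A ∧
          (∀ᵐ ω ∂μ, γe (x ω) = A * x ω) ∧
          α = optimalCombining σv σw A ∧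
          (∀ᵐ ω ∂μ, γd (decoderInput x v w γe α ω) =
            optimalGain σx σv σw A * decoderInput x v w γe α ω)) := by
  obtain ⟨hα0, hα1⟩ := hα
  have hσx' : (0 : ℝ) < σx := hσx
  have hσv' : (0 : ℝ) < σv := hσv
  have hσw' : (0 : ℝ) < σw := hσw
  have hmeas : ∀ i, AEMeasurable (![x, v, w] i) μ := by
    intro i
    fin_cases i
    exacts [hx.aemeasurable, hv.aemeasurable, hw.aemeasurable]
  have hvw : IndepFun v w μ := hindep.indepFun (i := 1) (j := 2) (by decide)
  obtain ⟨b, hb, hN⟩ := hasLaw_linear_combination_gaussianReal hv hw hvw α (1 - α)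
  push_cast at hb
  have hb' : (0 : ℝ) < b := hb ▸ combining_noise_pos hσv' hσw'
  have hb0 : b ≠ 0 := (NNReal.coe_pos.1 hb').ne'
  have hxN : IndepFun x (fun ω ↦ α * v ω + (1 - α) * w ω) μ :=
    ((hindep.indepFun_prodMk₀ hmeas 1 2 0 (by decide) (by decide)).comp
      (φ := fun p : ℝ × ℝ ↦ α * p.1 + (1 - α) * p.2) (by fun_prop) measurable_id).symm
  set N : Ω → ℝ := fun ω ↦ α * v ω + (1 - α) * w ω with hNdef
  have hxL := hx.memLp_two_of_gaussianReal
  have hx2 : ∫ ω, x ω ^ 2 ∂μ = (σx : ℝ) ^ 2 := by simpa using hx.integral_sq_of_gaussianReal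
  have hmL : MemLp (fun ω ↦ γe (x ω)) 2 μ :=
    (memLp_two_iff_integrable_sq
      (hγe.comp_aemeasurable hx.aemeasurable).aestronglyMeasurable).2 hpow
  set T : ℝ := P / (σv : ℝ) ^ 2 + (σx : ℝ) ^ 2 / (σw : ℝ) ^ 2 + 1 with hT
  have hP2 : ∫ ω, γe (x ω) ^ 2 ∂μ = P := hP.symm
  have hP0 : 0 ≤ P := hP2 ▸ integral_nonneg fun _ ↦ sq_nonneg _
  have hT0 : 0 < T := by positivity
  have hfx : MemLp (fun ω ↦ (fun t ↦ α * γe t + (1 - α) * t) (x ω)) 2 μ :=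
    (hmL.const_mul α).add (hxL.const_mul (1 - α))
  have hr : decoderInput x v w γe α =
      fun ω ↦ (fun t ↦ α * γe t + (1 - α) * t) (x ω) + N ω := by
    ext ω
    simp only [decoderInput, hNdef]
    ring
  have hge := gaussianChannel_lintegral_sq_error_ge (g := γd)
    (f := fun t ↦ α * γe t + (1 - α) * t) (pow_ne_zero 2 hσx.ne') hb0 hx hN hxN
    (by fun_prop) hγd hfx
  have hQ := integral_sq_linear_combination hmL hxL α (1 - α)
  rw [hP2, hx2] at hQ
  set C := ∫ ω, γe (x ω) * x ω ∂μ with hC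
  set Q := ∫ ω, (α * γe (x ω) + (1 - α) * x ω) ^ 2 ∂μ with hQdef
  have hQ0 : 0 ≤ Q := integral_nonneg fun _ ↦ sq_nonneg _
  have hE : estimationError μ x v w γe α γd =
      ∫⁻ ω, ENNReal.ofReal ((x ω - γd ((fun t ↦ α * γe t + (1 - α) * t) (x ω) + N ω)) ^ 2) ∂μ := by
    rw [estimationError, hr]
  rw [← hE] at hge
  push_cast at hge
  -- `A` is the gain of the linear encoder with the same power `P`.
  obtain ⟨A, hA0, hPA⟩ : ∃ A : ℝ, 0 ≤ A ∧ P = A ^ 2 * (σx : ℝ) ^ 2 :=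
    ⟨√P / σx, by positivity, by rw [div_pow, Real.sq_sqrt hP0]; field_simp⟩
  have hDL : MemLp (fun ω ↦ 1 * γe (x ω) + -A * x ω) 2 μ :=
    (hmL.const_mul 1).add (hxL.const_mul (-A))
  have hV : ∫ ω, (1 * γe (x ω) + -A * x ω) ^ 2 ∂μ = 2 * A * (A * (σx : ℝ) ^ 2 - C) := by
    rw [integral_sq_linear_combination hmL hxL, hP2, hx2, ← hC, hPA]
    ring
  have hlin : 2 * A * (A * (σx : ℝ) ^ 2 - C) = 0 → ∀ᵐ ω ∂μ, γe (x ω) = A * x ω := by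
    intro h
    filter_upwards [hDL.ae_eq_zero_of_integral_sq_eq_zero (hV.trans h)] with ω hω
    linarith
  -- Cauchy–Schwarz for `E[m x]`, read off from `E[(m - A x)²] ≥ 0`. Dividing by `2 A` needs `A >
  -- 0`; if `A = 0` then `m = 0` almost surely.
  have hCS : 0 ≤ A * (σx : ℝ) ^ 2 - C := by
    rcases hA0.eq_or_lt with h | h
    · subst h
      have hC0 : C = 0 := by
        rw [hC, integral_congr_ae (g := fun _ ↦ 0), integral_zero]
        filter_upwards [hlin (by ring)] with ω hω
        simp [hω]
      simp [hC0]
    · have : 0 ≤ 2 * A * (A * (σx : ℝ) ^ 2 - C) := hV ▸ integral_nonneg fun _ ↦ sq_nonneg _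
      exact nonneg_of_mul_nonneg_right this (by positivity)
  have hgap := combining_snr_gap (sx := σx) (A := A) (C := C) (T := T) hσv'.ne' hσw'.ne' hb
    (hPA ▸ hQ) (hPA ▸ hT)
  have hslack : 0 ≤ 2 * (α * (1 - α)) * (A * (σx : ℝ) ^ 2 - C) :=
    mul_nonneg (by have := sub_nonneg.2 hα1; positivity) hCS
  have hle : (σx : ℝ) ^ 2 / T ≤ (σx : ℝ) ^ 2 * b / (Q + b) := by
    rw [div_le_div_iff₀ hT0 (by positivity)]
    have : Q + b ≤ b * T := by
      nlinarith [sq_nonneg (α * σv * σx / σw - (1 - α) * σw * A * σx / σv)]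
    nlinarith [mul_le_mul_of_nonneg_left this (sq_nonneg (σx : ℝ))]
  have hlinear (A : ℝ) (hA : 0 ≤ A) (hm : ∀ᵐ ω ∂μ, γe (x ω) = A * x ω)
      (hαA : α = optimalCombining σv σw A) :
      estimationError μ x v w γe α γd = ENNReal.ofReal ((σx : ℝ) ^ 2 / T) ↔
        ∀ᵐ ω ∂μ, γd (decoderInput x v w γe α ω) =
          optimalGain σx σv σw A * decoderInput x v w γe α ω := by
    have hP' : P = A ^ 2 * (σx : ℝ) ^ 2 := by
      rw [← hP2, ← hx2, ← integral_const_mul]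
      refine integral_congr_ae ?_
      filter_upwards [hm] with ω hω
      rw [hω]; ring
    have hrm : ∀ᵐ ω ∂μ, decoderInput x v w γe α ω = (α * A + (1 - α)) * x ω + N ω := by
      filter_upwards [hm] with ω hω
      simp only [hr, hω]
      ring
    have hD : 0 < A * (σw : ℝ) ^ 2 + (σv : ℝ) ^ 2 := by positivity
    have hb'' : (b : ℝ) = (A * σw ^ 2 / (A * σw ^ 2 + σv ^ 2)) ^ 2 * σv ^ 2 +
        (1 - A * σw ^ 2 / (A * σw ^ 2 + σv ^ 2)) ^ 2 * σw ^ 2 := by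
      rw [hb, hαA, optimalCombining]
    have hβ : α * A + (1 - α) = (A ^ 2 * σw ^ 2 + σv ^ 2) / (A * σw ^ 2 + σv ^ 2) := by
      rw [hαA, optimalCombining]
      field_simp
      ring
    have hbval : (b : ℝ) = σv ^ 2 * σw ^ 2 * (A ^ 2 * σw ^ 2 + σv ^ 2) /
        (A * σw ^ 2 + σv ^ 2) ^ 2 := by
      rw [hb'']
      field_simp
      ring
    have hK : optimalGain σx σv σw A = (α * A + (1 - α)) * (σx : ℝ) ^ 2 /
        ((α * A + (1 - α)) ^ 2 * (σx : ℝ) ^ 2 + b) := by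
      rw [hβ, hbval, optimalGain]
      field_simp
    have hmin : (σx : ℝ) ^ 2 / T = (σx : ℝ) ^ 2 * b /
        ((α * A + (1 - α)) ^ 2 * (σx : ℝ) ^ 2 + b) := by
      rw [hβ, hbval, hT, hP']
      field_simp
    have key := gaussianChannel_lintegral_sq_error_eq_iff hb0 hx hN hxN hγd (α * A + (1 - α))
    push_cast at key
    rw [← hK, ← hmin] at key
    have hE' : estimationError μ x v w γe α γd =
        ∫⁻ ω, ENNReal.ofReal ((x ω - γd ((α * A + (1 - α)) * x ω + N ω)) ^ 2) ∂μ := by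
      refine lintegral_congr_ae ?_
      filter_upwards [hrm] with ω hω
      rw [hω]
    rw [hE', key]
    refine Filter.eventually_congr ?_
    filter_upwards [hrm] with ω hω
    rw [hω]
  refine ⟨(ENNReal.ofReal_le_ofReal hle).trans hge, fun h ↦ ?_, ?_⟩
  · rw [h, ENNReal.ofReal_le_ofReal_iff (by positivity),
      div_le_div_iff₀ (by positivity) hT0] at hge
    have hQb : b * T ≤ Q + b :=
      le_of_mul_le_mul_left (by linarith) (by positivity : 0 < (σx : ℝ) ^ 2)
    have hsq := sq_nonneg (α * σv * σx / σw - (1 - α) * σw * A * σx / σv)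
    -- Both nonnegative terms of the gap vanish; this one determines `α`.
    have h1 : α * σv * σx / σw - (1 - α) * σw * A * σx / σv = 0 :=
      pow_eq_zero_iff two_ne_zero |>.1 (by linarith)
    have h2 : 2 * (α * (1 - α)) * (A * (σx : ℝ) ^ 2 - C) = 0 := by linarith
    have hαA : α = optimalCombining σv σw A := by
      rw [optimalCombining, eq_div_iff (by positivity)]
      rw [sub_eq_zero, div_eq_div_iff hσw'.ne' hσv'.ne'] at h1
      have h3 := mul_right_cancel₀ hσx'.ne' (show (α * σv ^ 2) * (σx : ℝ) =
        ((1 - α) * σw ^ 2 * A) * σx by linarith)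
      linarith
    have hm : ∀ᵐ ω ∂μ, γe (x ω) = A * x ω := by
      refine hlin ?_
      -- For `A > 0` the optimal `α` lies strictly between 0 and 1, so `h2` forces equality in
      -- Cauchy–Schwarz.
      rcases hA0.eq_or_lt with hA | hA
      · rw [← hA]; ring
      · have hα0' : 0 < α := by rw [hαA, optimalCombining]; positivity
        have hα1' : 0 < 1 - α := by
          have : 1 - α = σv ^ 2 / (A * σw ^ 2 + σv ^ 2) := by
            rw [hαA, optimalCombining]; field_simp; ring
          rw [this]; positivity
        rw [(mul_eq_zero_iff_left (by positivity)).1 h2, mul_zero]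
    exact ⟨A, hA0, hm, hαA, (hlinear A hA0 hm hαA).1 h⟩
  · rintro ⟨A, hA, hm, hαA, hd⟩
    exact (hlinear A hA hm hαA).2 hd
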